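/- An addition chain of length $r$ for $n$ is a sequence $(a_0,a_1,\dots,a_r)$ with $a_0=1$, $a_r=n$ such that for each $1\le m\le r$ there are $0\le i,j<m$ with $a_m=a_i+a_j$. For a set $A$ of addition chains, let $\ell^A(n)$ denote the least length of a chain in $A$ for the positive integer $n$. Call $A$ admissible if for every positive integer $n$ there is a chain in $A$ for $n$ of length at most $\lfloor\log_2 n\rfloor+\nu_2(n)-1$, where $\nu_2(n)$ is the number of $1$'s in the binary expansion of $n$, and $\ell^A(2n)\le\ell^A(n)+1$ for every positive integer $n$. Let $A$ be admissible, and put $\delta^A(n)=\ell^A(n)-\log_2 n$ and $\mathscr D^A=\{\delta^A(n): n\ge 1\}$. Call $m\ge 1$ $A$-stable if $\ell^A(2^j m)=j+\ell^A(m)$ for all $j\ge 0$, and put $\mathscr D^A_{st}=\{\delta^A(m): m\ge 1 \text{ is } A\text{-stable}\}$. For an integer $k\ge 0$, let $f^A(k)$ be the supremum of the initial $\omega^k$ elements of $\mathscr D^A$, and $f^A_{st}(k)$ the supremum of the initial $\omega^k$ elements of $\mathscr D^A_{st}$. Let $$C_s=\frac23+\frac23\log_2 3-\frac1{\ln 2}-\log_2\ln\frac43+\sum_{j=0}^\infty\log_2\left(1+2^{-6\cdot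 2^j+1}\right),$$ where the series converges. Then $f^A(k)$ and $f^A_{st}(k)$ are well defined for every integer $k\ge 0$ (that is, $\mathscr D^A$ and $\mathscr D^A_{st}$ are well-ordered subsets of $\mathbb R$, each has an initial segment of order type $\omega^k$, and these initial segments are bounded above), and $$\log_2(k+1)-2.13<\log_2(k+1)-C_s<f^A(k)\le f^A_{st}(k)\le k .$$ -/

import Mathlib

/-- An addition chain `(a_0, …, a_r)`: a finite sequence with `a_0 = 1` in which every later term is
the sum of two (not necessarily distinct) earlier terms.  The length is `r`. -/
structure AdditionChain where
  /-- The length `r` of the chain (one less than the number of terms). -/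
  length : ℕ
  /-- The terms `a_0, …, a_r`. -/
  seq : Fin (length + 1) → ℕ
  seq_zero : seq 0 = 1
  seq_step : ∀ k : Fin (length + 1), k ≠ 0 → ∃ i j : Fin (length + 1),
    i < k ∧ j < k ∧ seq k = seq i + seq j

namespace AdditionChain

/-- The number `n = a_r` that the chain is a chain for. -/
def target (c : AdditionChain) : ℕ := c.seq (Fin.last c.length)

end AdditionChain

/-- `ν₂(n)`, the number of ones in the binary expansion of `n`. -/
def binaryOnes (n : ℕ) : ℕ := (Nat.digits 2 n).count 1

/-- `ℓ^A(n)`, the least length of a chain for `n` that belongs to `A`. -/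
noncomputable def chainLength (A : Set AdditionChain) (n : ℕ) : ℕ :=
  sInf {r : ℕ | ∃ c ∈ A, c.target = n ∧ c.length = r}

/-- Admissible sets of addition chains.  For `n ≥ 1` one has `ν₂(n) ≥ 1` and
`Nat.log 2 n = ⌊log₂ n⌋`, so the first bound is `⌊log₂ n⌋ + ν₂(n) - 1`. -/
structure IsAdmissible (A : Set AdditionChain) : Prop where
  exists_short : ∀ n : ℕ, 0 < n →
    ∃ c ∈ A, c.target = n ∧ c.length ≤ Nat.log 2 n + binaryOnes n - 1
  length_double : ∀ n : ℕ, 0 < n → chainLength A (2 * n) ≤ chainLength A n + 1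

/-- The `A`-defect `δ^A(n) = ℓ^A(n) - log₂ n`. -/
noncomputable def defect (A : Set AdditionChain) (n : ℕ) : ℝ :=
  (chainLength A n : ℝ) - Real.logb 2 (n : ℝ)

/-- `m` is `A`-stable if `ℓ^A(2^k m) = k + ℓ^A(m)` for all `k ≥ 0`. -/
def IsStableNumber (A : Set AdditionChain) (m : ℕ) : Prop :=
  ∀ k : ℕ, chainLength A (2 ^ k * m) = k + chainLength A m

/-- The set of all `A`-defects of positive integers. -/
def defectSet (A : Set AdditionChain) : Set ℝ :=
  {x : ℝ | ∃ n : ℕ, 0 < n ∧ defect A n = x}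

/-- The set of all `A`-stable defects, i.e. the defects of `A`-stable positive integers. -/
def stableDefectSet (A : Set AdditionChain) : Set ℝ :=
  {x : ℝ | ∃ n : ℕ, 0 < n ∧ IsStableNumber A n ∧ defect A n = x}

/-- The initial `α` elements of a set `S` of reals: those `x ∈ S` whose set of predecessors in `S`
has order type some ordinal `β < α` (that is, `x` is the `β`-th element of `S`, counted from 0). -/
def initialElements (S : Set ℝ) (α : Ordinal.{0}) : Set ℝ :=
  {x : ℝ | x ∈ S ∧ ∃ β : Ordinal.{0}, β < α ∧
    Nonempty ({y : ℝ | y ∈ S ∧ y < x} ≃o Set.Iio β)}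

/-- The supremum of the initial `ω ^ k` elements of `S`. -/
noncomputable def omegaCutoff (S : Set ℝ) (k : ℕ) : ℝ :=
  sSup (initialElements S (Ordinal.omega0 ^ k))

/-- `f^A(k)`, the supremum of the initial `ω ^ k` defects. -/
noncomputable def cutoff (A : Set AdditionChain) (k : ℕ) : ℝ :=
  omegaCutoff (defectSet A) k

/-- `f^A_st(k)`, the supremum of the initial `ω ^ k` stable defects. -/
noncomputable def stableCutoff (A : Set AdditionChain) (k : ℕ) : ℝ :=
  omegaCutoff (stableDefectSet A) k

/-- `S` is a well-ordered set of reals that has at least `ω ^ k` elements, and its initial `ω ^ k`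
elements have a least upper bound, namely `omegaCutoff S k`. -/
def HasOmegaCutoff (S : Set ℝ) (k : ℕ) : Prop :=
  S.IsWF ∧
  Nonempty (initialElements S (Ordinal.omega0 ^ k) ≃o Set.Iio (Ordinal.omega0.{0} ^ k)) ∧
  IsLUB (initialElements S (Ordinal.omega0 ^ k)) (omegaCutoff S k)

/-- The `k`-th term `log₂ (1 + 2^(-6·2^k + 1))` of the series in Schönhage's constant. -/
noncomputable def schonhageTerm (k : ℕ) : ℝ :=
  Real.logb 2 (1 + (2 : ℝ) ^ (-6 * 2 ^ k + 1 : ℤ))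

/-- Schönhage's constant `C_s`. -/
noncomputable def schonhageConst : ℝ :=
  2 / 3 + 2 / 3 * Real.logb 2 3 - 1 / Real.log 2 - Real.logb 2 (Real.log (4 / 3))
    + ∑' k : ℕ, schonhageTerm k

/-! Let the derived set of S consist of the limits of S from the left. For well-ordered S ⊆ ℝ, a
point y of the k-th derived set forces ω^k elements of S at or below y; conversely, order type at
least ω^k below T yields a point of the k-th derived set of S ∩ (-∞, T)
(`segType_add_omega0_pow_le`, `exists_mem_leftDeriv_iterate`). So both bounds concern derived sets,
which commute with finite unions and translations.

Upper bound: appending a distant binary one to n lowers ⌊log₂ n⌋ - log₂ n by an amount tending to 0,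
so 0 lies in the k-th derived set of the values coming from numbers with k+1 ones. A stable multiple
2^K n has defect equal to that value plus an integer in {0, …, k}, so some integer at most k lies in
the k-th derived set of the stable defects.

Lower bound: if f steps of a chain for n do not double the current maximum, then f ≤ 4δ(n), and n is
a sum of at most 2^f powers of two whose exponents are linear in f+1 integer parameters
(`IsChainSet.exists_structure`). A left limit of such sums loses some terms and at least one
dimension (`leftDeriv_negLogSum_subset`), so derived sets of order above f+1 are empty. The same
description gives well-ordering. Every T < (k-1)/4 is thus below the cutoff, and the bound with C_s
follows from log₂(k+1) ≤ (k+6)/4 and C_s > 7/4. -/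

/-! ### Left derived sets of sets of reals -/

section LeftDerivedSets

open Filter Topology

/-- The points of `ℝ` that are limits of points of `S` lying strictly to their left. -/
def leftDeriv (S : Set ℝ) : Set ℝ := {z | ∃ᶠ x in 𝓝[<] z, x ∈ S}

theorem leftDeriv_mono : Monotone leftDeriv := fun _ _ h _ hz => hz.mono fun _ hx => h hx

theorem leftDeriv_iterate_mono (k : ℕ) : Monotone (leftDeriv^[k]) := leftDeriv_mono.iterate k

theorem exists_between_of_mem_leftDeriv {S : Set ℝ} {z y : ℝ} (hz : z ∈ leftDeriv S) (hy : y < z) :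
    ∃ x ∈ S, y < x ∧ x < z := by
  have h := (show ∃ᶠ x in 𝓝[<] z, x ∈ S from hz).and_eventually (Ioo_mem_nhdsLT hy)
  obtain ⟨x, hx, hx'⟩ := h.exists
  exact ⟨x, hx, hx'.1, hx'.2⟩

theorem mem_leftDeriv_of_forall {S : Set ℝ} {z : ℝ} (h : ∀ y < z, ∃ x ∈ S, y < x ∧ x < z) :
    z ∈ leftDeriv S := by
  refine ((nhdsLT_basis z).frequently_iff).2 fun y hy => ?_
  obtain ⟨x, hx, h1, h2⟩ := h y hy
  exact ⟨x, ⟨h1, h2⟩, hx⟩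

theorem leftDeriv_empty : leftDeriv ∅ = ∅ := by
  ext z; simp [leftDeriv]

theorem leftDeriv_iUnion {ι : Type*} [Finite ι] (S : ι → Set ℝ) :
    leftDeriv (⋃ i, S i) = ⋃ i, leftDeriv (S i) := by
  ext z
  simp only [leftDeriv, Set.mem_iUnion, Set.mem_ofPred_eq, frequently_exists]

theorem leftDeriv_iterate_iUnion {ι : Type*} [Finite ι] (k : ℕ) (S : ι → Set ℝ) :
    leftDeriv^[k] (⋃ i, S i) = ⋃ i, leftDeriv^[k] (S i) := by
  induction k generalizing S with
  | zero => rfl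
  | succ k ih => simp only [Function.iterate_succ_apply, leftDeriv_iUnion, ih]

theorem leftDeriv_iterate_empty (k : ℕ) : leftDeriv^[k] ∅ = ∅ :=
  Function.iterate_fixed leftDeriv_empty k

theorem leftDeriv_preimage_add (c : ℝ) (S : Set ℝ) :
    leftDeriv ((· + c) ⁻¹' S) = (· + c) ⁻¹' leftDeriv S := by
  ext z
  constructor
  · intro hz
    refine mem_leftDeriv_of_forall fun y hy => ?_
    obtain ⟨x, hx, h1, h2⟩ := exists_between_of_mem_leftDeriv hz (y := y - c) (by linarith [hy])
    exact ⟨x + c, hx, by linarith, by linarith⟩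
  · intro hz
    refine mem_leftDeriv_of_forall fun y hy => ?_
    obtain ⟨x, hx, h1, h2⟩ := exists_between_of_mem_leftDeriv (z := z + c) hz (y := y + c)
      (by linarith [hy])
    exact ⟨x - c, by simpa using hx, by linarith, by linarith⟩

theorem leftDeriv_iterate_preimage_add (k : ℕ) (c : ℝ) (S : Set ℝ) :
    leftDeriv^[k] ((· + c) ⁻¹' S) = (· + c) ⁻¹' (leftDeriv^[k] S) := by
  induction k generalizing S with
  | zero => rfl
  | succ k ih => simp only [Function.iterate_succ_apply, leftDeriv_preimage_add, ih]

end LeftDerivedSets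

/-! ### Order types of initial segments versus iterated derived sets -/

section SegmentTypes

open Ordinal

/-- The order type of the set of elements of `S` below `x`. -/
noncomputable def segType (S : Set ℝ) [WellFoundedLT S] (x : ℝ) : Ordinal.{0} :=
  Ordinal.type (fun a b : {y : S // (y : ℝ) < x} => a < b)

variable {S : Set ℝ} [WellFoundedLT S]

theorem segType_eq_iff {x : ℝ} {β : Ordinal.{0}} :
    segType S x = β ↔ Nonempty ({y : ℝ | y ∈ S ∧ y < x} ≃o Set.Iio β) := by
  let e : {y : S // (y : ℝ) < x} ≃o {y : ℝ | y ∈ S ∧ y < x} :=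
    { toFun := fun y => ⟨y.1.1, y.1.2, y.2⟩
      invFun := fun y => ⟨⟨y.1, y.2.1⟩, y.2.2⟩
      left_inv := fun _ => rfl
      right_inv := fun _ => rfl
      map_rel_iff' := Iff.rfl }
  conv_lhs => rw [← type_toType β]
  rw [segType, Ordinal.type_eq]
  constructor
  · rintro ⟨f⟩
    exact ⟨e.symm.trans ((OrderIso.ofRelIsoLT f).trans ToType.mk.symm)⟩
  · rintro ⟨f⟩
    exact ⟨(e.trans (f.trans ToType.mk)).toRelIsoLT⟩

theorem segType_mono : Monotone (segType S) := by
  intro x y h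
  refine Ordinal.type_le_iff'.2 ⟨⟨⟨fun a => ⟨a.1, a.2.trans_le h⟩, ?_⟩, Iff.rfl⟩⟩
  intro a b hab
  simpa [Subtype.ext_iff] using hab

theorem typein_eq_segType {s y : ℝ} (hs : s ∈ S) (hsy : s < y) :
    typein (fun a b : {a : S // (a : ℝ) < y} => a < b) ⟨⟨s, hs⟩, hsy⟩ = segType S s := by
  rw [← Ordinal.type_subrel]
  refine Ordinal.type_eq.2 ⟨⟨⟨fun a => ⟨a.1.1, a.2⟩, fun a => ⟨⟨a.1, a.2.trans hsy⟩, a.2⟩,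
    fun _ => rfl, fun _ => rfl⟩, Iff.rfl⟩⟩

theorem segType_lt_segType {x s y : ℝ} (hs : s ∈ S) (hxs : x ≤ s) (hsy : s < y) :
    segType S x < segType S y := by
  refine (segType_mono hxs).trans_lt ?_
  rw [← typein_eq_segType hs hsy]
  exact typein_lt_type _ _

theorem lt_of_segType_lt {x y : ℝ} (h : segType S x < segType S y) : x < y :=
  lt_of_not_ge fun h' => (segType_mono h').not_gt h

theorem exists_segType_eq {α : Ordinal.{0}} {y : ℝ} (h : α < segType S y) :
    ∃ s ∈ S, s < y ∧ segType S s = α := by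
  obtain ⟨⟨⟨s, hs⟩, hsy⟩, h⟩ := typein_surj _ h
  exact ⟨s, hs, hsy, (typein_eq_segType hs hsy).symm.trans h⟩

theorem mem_initialElements {α : Ordinal.{0}} {x : ℝ} :
    x ∈ initialElements S α ↔ x ∈ S ∧ segType S x < α := by
  simp only [initialElements, Set.mem_ofPred_eq, ← segType_eq_iff]
  exact and_congr_right fun _ => ⟨fun ⟨β, hβ, h⟩ => h ▸ hβ, fun h => ⟨_, h, rfl⟩⟩

theorem nonempty_initialElements_orderIso {α : Ordinal.{0}} {y : ℝ} (h : α ≤ segType S y) :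
    Nonempty (initialElements S α ≃o Set.Iio α) := by
  let f : initialElements S α → Set.Iio α := fun x => ⟨segType S x, (mem_initialElements.1 x.2).2⟩
  have hf : StrictMono f := fun a b hab =>
    segType_lt_segType (mem_initialElements.1 a.2).1 le_rfl hab
  refine ⟨hf.orderIsoOfSurjective f fun β => ?_⟩
  obtain ⟨s, hs, -, hβ⟩ := exists_segType_eq (lt_of_lt_of_le β.2 h)
  exact ⟨⟨s, mem_initialElements.2 ⟨hs, hβ ▸ β.2⟩⟩, Subtype.ext hβ⟩

theorem le_segType_of_orderIso {α : Ordinal.{0}} {y : ℝ}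
    (h : Nonempty (initialElements S α ≃o Set.Iio α)) (hy : ∀ x ∈ initialElements S α, x < y) :
    α ≤ segType S y := by
  obtain ⟨f⟩ := h
  rw [← type_toType α]
  let g := ToType.mk.symm.trans f.symm
  refine Ordinal.type_le_iff'.2 ⟨⟨⟨fun a => ⟨⟨g a, (g a).2.1⟩, hy _ (g a).2⟩, ?_⟩, ?_⟩⟩
  · intro a b hab
    exact g.injective (Subtype.ext (congrArg (fun u => (u.1.1 : ℝ)) hab))
  · intro a b
    exact g.lt_iff_lt

/-- ω^(k+1) is the supremum of the ω^k · n, and between x and a point of the next derived set one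
finds n successive points of the k-th, each contributing a block ω^k. -/
theorem segType_add_omega0_pow_le (k : ℕ) {x y z : ℝ} (hy : y ∈ leftDeriv^[k] S) (hxy : x < y)
    (hyz : y < z) : segType S x + ω ^ k ≤ segType S z := by
  induction k generalizing x y z with
  | zero =>
    rw [pow_zero, ← Order.succ_eq_add_one, Order.succ_le_iff]
    exact segType_lt_segType hy hxy.le hyz
  | succ k ih =>
    rw [Function.iterate_succ_apply'] at hy
    refine le_trans ?_ (segType_mono hyz.le)
    have key : ∀ (n : ℕ) (x : ℝ), x < y → segType S x + ω ^ k * n ≤ segType S y := by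
      intro n
      induction n with
      | zero => intro x hx; simpa using segType_mono hx.le
      | succ n ihn =>
        intro x hx
        obtain ⟨w, hw, h1, h2⟩ := exists_between_of_mem_leftDeriv hy hx
        obtain ⟨w', h3, h4⟩ := exists_between h2
        refine le_trans ?_ (ihn w' h4)
        -- Ordinal addition does not commute: the new block lies to the left of the other n.
        rw [add_comm n 1, Nat.cast_add, mul_add, Nat.cast_one, mul_one, ← add_assoc]
        gcongr
        exact ih hw h1 h3
    rw [pow_succ, add_le_iff_of_isSuccLimit]
    · intro d hd
      rw [lt_mul_iff_of_isSuccLimit isSuccLimit_omega0] at hd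
      obtain ⟨c, hc, hd⟩ := hd
      obtain ⟨n, rfl⟩ := lt_omega0.1 hc
      exact (add_le_add_right hd.le _).trans (key n x hxy)
    · exact isSuccLimit_mul_right (pow_pos omega0_pos k) isSuccLimit_omega0

/-- Cut ω^(k+1) into consecutive blocks ω^k; each block yields a point of the k-th derived set, and
the supremum of these points is the required limit. -/
theorem exists_mem_leftDeriv_iterate (k : ℕ) {α : Ordinal.{0}} {y : ℝ}
    (h : α + ω ^ k ≤ segType S y) :
    ∃ z ∈ leftDeriv^[k] (S ∩ Set.Iio y), z ≤ y ∧ α ≤ segType S z := by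
  induction k generalizing α y with
  | zero =>
    rw [pow_zero, ← Order.succ_eq_add_one, Order.succ_le_iff] at h
    obtain ⟨s, hs, hsy, hα⟩ := exists_segType_eq h
    exact ⟨s, ⟨hs, hsy⟩, hsy.le, hα.ge⟩
  | succ k ih =>
    have hpos : (0 : Ordinal.{0}) < ω ^ k := pow_pos omega0_pos k
    have h1 : ∀ n : ℕ, ∃ s ∈ S, s < y ∧ segType S s = α + ω ^ k * (n + 1 : ℕ) := by
      intro n
      refine exists_segType_eq (lt_of_lt_of_le ?_ h)
      rw [pow_succ]
      gcongr
      exact natCast_lt_omega0 _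
    choose s hs hsy hsα using h1
    have h2 : ∀ n : ℕ, ∃ z ∈ leftDeriv^[k] (S ∩ Set.Iio (s n)), z ≤ s n ∧
        α + ω ^ k * n ≤ segType S z := by
      intro n
      refine ih ?_
      rw [hsα, Nat.cast_add, mul_add, Nat.cast_one, mul_one, add_assoc]
    choose z hz hzs hαz using h2
    -- Neighbouring points may coincide at `s n`; points two blocks apart cannot.
    have hlt : ∀ n, z n < z (n + 2) := by
      intro n
      apply lt_of_segType_lt (S := S)
      refine (segType_mono (hzs n)).trans_lt (lt_of_lt_of_le ?_ (hαz _))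
      rw [hsα]
      gcongr
      exact_mod_cast Nat.lt_succ_self _
    have hbdd : BddAbove (Set.range z) := ⟨y, by
      rintro _ ⟨n, rfl⟩; exact (hzs n).trans (hsy n).le⟩
    refine ⟨sSup (Set.range z), ?_, ?_, ?_⟩
    · rw [Function.iterate_succ_apply']
      refine mem_leftDeriv_of_forall fun t ht => ?_
      obtain ⟨_, ⟨n, rfl⟩, hn⟩ := exists_lt_of_lt_csSup (Set.range_nonempty z) ht
      refine ⟨z n, ?_, hn, (hlt n).trans_le (le_csSup hbdd ⟨_, rfl⟩)⟩
      exact leftDeriv_iterate_mono k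
        (Set.inter_subset_inter_right S (Set.Iio_subset_Iio (hsy n).le)) (hz n)
    · exact csSup_le (Set.range_nonempty z) (by
        rintro _ ⟨n, rfl⟩; exact (hzs n).trans (hsy n).le)
    · refine le_trans ?_ (segType_mono (le_csSup hbdd ⟨0, rfl⟩))
      simpa using hαz 0

theorem initialElements_omega0_pow_le {k : ℕ} {y : ℝ} (hy : y ∈ leftDeriv^[k] S) :
    ∀ x ∈ initialElements S (ω ^ k), x ≤ y := by
  intro x hx
  by_contra! hc
  have h1 := segType_add_omega0_pow_le k hy (sub_one_lt y) hc
  exact ((le_add_self).trans h1).not_gt (mem_initialElements.1 hx).2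

theorem omega0_pow_le_segType {k : ℕ} {y : ℝ} (hy : y ∈ leftDeriv^[k] S) :
    ω ^ k ≤ segType S (y + 1) :=
  le_add_self.trans (segType_add_omega0_pow_le k hy (sub_one_lt y) (lt_add_one y))

theorem initialElements_omega0_pow_nonempty {k : ℕ} {y : ℝ} (hy : y ∈ leftDeriv^[k] S) :
    (initialElements S (ω ^ k)).Nonempty := by
  obtain ⟨f⟩ := nonempty_initialElements_orderIso (omega0_pow_le_segType hy)
  exact ⟨_, (f.symm ⟨0, Set.mem_Iio.2 (pow_pos omega0_pos k)⟩).2⟩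

theorem hasOmegaCutoff_of_mem_leftDeriv {k : ℕ} {y : ℝ} (hy : y ∈ leftDeriv^[k] S) :
    HasOmegaCutoff S k :=
  ⟨‹WellFoundedLT S›.wf, nonempty_initialElements_orderIso (omega0_pow_le_segType hy),
    isLUB_csSup (initialElements_omega0_pow_nonempty hy) ⟨y, initialElements_omega0_pow_le hy⟩⟩

theorem omegaCutoff_le_of_mem_leftDeriv {k : ℕ} {y : ℝ} (hy : y ∈ leftDeriv^[k] S) :
    omegaCutoff S k ≤ y :=
  csSup_le (initialElements_omega0_pow_nonempty hy) (initialElements_omega0_pow_le hy)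

end SegmentTypes

/-! ### Comparing cutoffs -/

section Cutoffs

open Ordinal

/-- For k > 0 the type ω^k has no last element, so a supremum at most T would put all ω^k elements
strictly below T. For k = 0 the supremum is attained, hence the extra hypothesis `h0`. -/
theorem lt_omegaCutoff {S : Set ℝ} {k : ℕ} {T : ℝ} (hS : HasOmegaCutoff S k)
    (hT : leftDeriv^[k] (S ∩ Set.Iio T) = ∅) (h0 : k = 0 → S ⊆ Set.Ioi T) :
    T < omegaCutoff S k := by
  have : WellFoundedLT S := ⟨hS.1⟩
  obtain ⟨-, hiso, hlub⟩ := hS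
  obtain rfl | hk := Nat.eq_zero_or_pos k
  · obtain ⟨f⟩ := hiso
    let x := f.symm ⟨0, Set.mem_Iio.2 (pow_pos omega0_pos 0)⟩
    exact (h0 rfl x.2.1).trans_le (hlub.1 x.2)
  by_contra! hc
  have hlt : ∀ x ∈ initialElements S (ω ^ k), x < T := by
    intro x hx
    refine lt_of_lt_of_le ?_ hc
    obtain ⟨f⟩ := hiso
    have hlim : Order.IsSuccLimit ((ω : Ordinal.{0}) ^ k) := by
      obtain ⟨j, rfl⟩ := Nat.exists_eq_succ_of_ne_zero hk.ne'
      rw [pow_succ]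
      exact isSuccLimit_mul_right (pow_pos omega0_pos j) isSuccLimit_omega0
    let β := f ⟨x, hx⟩
    let y := f.symm ⟨Order.succ β.1, hlim.succ_lt β.2⟩
    have : (⟨x, hx⟩ : initialElements S (ω ^ k)) < y := by
      rw [← f.lt_iff_lt, OrderIso.apply_symm_apply]
      exact Order.lt_succ β.1
    exact lt_of_lt_of_le this (hlub.1 y.2)
  obtain ⟨z, hz, -⟩ := exists_mem_leftDeriv_iterate (S := S) k (α := 0) (y := T)
    (by rw [zero_add]; exact le_segType_of_orderIso hiso hlt)
  rw [hT] at hz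
  exact hz

theorem omegaCutoff_mono {S S' : Set ℝ} {k : ℕ} (hS : HasOmegaCutoff S k)
    (hS' : HasOmegaCutoff S' k) (h : S' ⊆ S) : omegaCutoff S k ≤ omegaCutoff S' k := by
  have : WellFoundedLT S := ⟨hS.1⟩
  have : WellFoundedLT S' := ⟨hS'.1⟩
  refine (isLUB_le_iff hS.2.2).2 fun x hx => ?_
  by_contra! hc
  have h1 := le_segType_of_orderIso hS'.2.1 fun y hy => (hS'.2.2.1 hy).trans_lt hc
  refine (h1.trans ?_).not_gt (mem_initialElements.1 hx).2
  refine Ordinal.type_le_iff'.2 ⟨⟨⟨fun a => ⟨⟨a.1.1, h a.1.2⟩, a.2⟩, ?_⟩, Iff.rfl⟩⟩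
  intro a b hab
  simpa [Subtype.ext_iff] using hab

end Cutoffs

/-! ### Derived sets of logarithms of sums of powers of two -/

section PowerSums

open Filter Topology

variable {ι : Type*}

/-- `-log₂ ∑_{j ∈ J} 2^{-b_j}`. -/
noncomputable def negLogSum (J : Finset ι) (b : ι → ℕ) : ℝ :=
  -Real.logb 2 (∑ j ∈ J, (1 / 2 : ℝ) ^ b j)

/-- The projection of `ι → ℚ` that annihilates the coordinates outside `J`. -/
def coordProj [DecidableEq ι] (J : Finset ι) : (ι → ℚ) →ₗ[ℚ] (ι → ℚ) where
  toFun v j := if j ∈ J then v j else 0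
  map_add' v w := by ext j; simp only [Pi.add_apply]; split_ifs <;> simp
  map_smul' c v := by ext j; simp

/-- Dickson's lemma: `ι → ℕ` is well-quasi-ordered, and `negLogSum J` is monotone on `B`. -/
theorem negLogSum_image_isPWO [Finite ι] (J : Finset ι) (B : Set (ι → ℕ))
    (hB : ∀ b ∈ B, 1 ≤ ∑ j ∈ J, (1 / 2 : ℝ) ^ b j) : (negLogSum J '' B).IsPWO := by
  refine Set.IsPWO.image_of_monotoneOn (Set.isPWO_of_wellQuasiOrderedLE B) ?_
  intro b hb b' hb' h
  refine neg_le_neg (Real.logb_le_logb_of_le one_lt_two (one_pos.trans_le (hB b' hb')) ?_)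
  exact Finset.sum_le_sum fun j _ => pow_le_pow_of_le_one (by norm_num) (by norm_num) (h j)

theorem tendsto_one_half_pow_of_ultrafilter {κ : Type*} (U : Ultrafilter κ) (f : κ → ℕ)
    (hf : ∀ n, ¬ ∀ᶠ x in U, f x = n) : Tendsto (fun x => (1 / 2 : ℝ) ^ f x) U (𝓝 0) := by
  refine (tendsto_pow_atTop_nhds_zero_of_lt_one (by norm_num) (by norm_num)).comp ?_
  rw [tendsto_atTop]
  intro n
  have : ∀ᶠ x in U, ∀ m ∈ Finset.range n, f x ≠ m := by
    rw [Finset.eventually_all]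
    intro m _
    exact Ultrafilter.eventually_not.2 (hf m)
  filter_upwards [this] with x hx
  by_contra! hc
  exact hx (f x) (Finset.mem_range.2 hc) rfl

/-- Along an ultrafilter approaching z from the left, each exponent is eventually constant or tends
to infinity. The constant ones form `J'`, and their terms alone produce z. As z is approached
strictly, two vectors agree on `J'` but differ in value; their projected difference is a nonzero
element of `Λ` killed by `coordProj J'`. -/
theorem leftDeriv_negLogSum_subset [DecidableEq ι] (J : Finset ι) (B : Set (ι → ℕ))
    (Λ : Submodule ℚ (ι → ℚ)) [FiniteDimensional ℚ Λ]
    (hB : ∀ b ∈ B, 1 ≤ ∑ j ∈ J, (1 / 2 : ℝ) ^ b j)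
    (hΛ : ∀ b ∈ B, ∀ b' ∈ B, coordProj J (fun j => (b j : ℚ) - b' j) ∈ Λ)
    {z : ℝ} (hz : z ∈ leftDeriv (negLogSum J '' B)) :
    ∃ J' ⊆ J, Module.finrank ℚ (Λ.map (coordProj J')) < Module.finrank ℚ Λ ∧
      z ∈ negLogSum J' '' {b ∈ B | 1 ≤ ∑ j ∈ J', (1 / 2 : ℝ) ^ b j} := by
  classical
  have hne : (comap (negLogSum J) (𝓝[<] z) ⊓ 𝓟 B).NeBot := by
    rw [← frequently_mem_iff_neBot]
    have h := (show ∃ᶠ x in 𝓝[<] z, x ∈ negLogSum J '' B from hz)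
    rw [frequently_comap]
    exact h.mono fun x ⟨b, hb, hx⟩ => ⟨b, hx, hb⟩
  set U := Ultrafilter.of (comap (negLogSum J) (𝓝[<] z) ⊓ 𝓟 B)
  have hU : (U : Filter (ι → ℕ)) ≤ comap (negLogSum J) (𝓝[<] z) ⊓ 𝓟 B := Ultrafilter.of_le _
  have hUB : ∀ᶠ b : ι → ℕ in U, b ∈ B := hU (mem_inf_of_right (mem_principal_self B))
  have hUz : Tendsto (negLogSum J) U (𝓝[<] z) :=
    tendsto_iff_comap.2 (hU.trans inf_le_left)
  set J' := J.filter fun j => ∃ n, ∀ᶠ b : ι → ℕ in U, b j = n with hJ'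
  have hJJ : J' ⊆ J := Finset.filter_subset _ _
  have hconst : ∀ j ∈ J', ∃ n, ∀ᶠ b : ι → ℕ in U, b j = n := fun j hj => (Finset.mem_filter.1 hj).2
  choose! β hβ using hconst
  have hUβ : ∀ᶠ b : ι → ℕ in U, ∀ j ∈ J', b j = β j := (Finset.eventually_all _).2 hβ
  have hlim : Tendsto (fun b : ι → ℕ => ∑ j ∈ J, (1 / 2 : ℝ) ^ b j) U
      (𝓝 (∑ j ∈ J', (1 / 2 : ℝ) ^ β j)) := by
    rw [hJ', Finset.sum_filter]
    refine tendsto_finsetSum _ fun j hj => ?_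
    split_ifs with h
    · exact tendsto_const_nhds.congr' ((hβ j (Finset.mem_filter.2 ⟨hj, h⟩)).mono fun b hb => by
        simp only [hb])
    · exact tendsto_one_half_pow_of_ultrafilter U (fun b => b j) (by simpa using h)
  -- The lower bound 1 survives the limit, so the logarithm is continuous there and the hypothesis
  -- can be reused for `J'`.
  have hone : 1 ≤ ∑ j ∈ J', (1 / 2 : ℝ) ^ β j := ge_of_tendsto hlim (hUB.mono hB)
  have hz' : z = -Real.logb 2 (∑ j ∈ J', (1 / 2 : ℝ) ^ β j) := by
    refine tendsto_nhds_unique (tendsto_nhds_of_tendsto_nhdsWithin hUz) ?_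
    exact ((Real.continuousAt_logb (by linarith)).tendsto.comp hlim).neg
  obtain ⟨b₁, hb₁, hb₁β⟩ := (hUB.and hUβ).exists
  have hsum : ∀ b : ι → ℕ, (∀ j ∈ J', b j = β j) →
      ∑ j ∈ J', (1 / 2 : ℝ) ^ b j = ∑ j ∈ J', (1 / 2 : ℝ) ^ β j :=
    fun b hb => Finset.sum_congr rfl fun j hj => by rw [hb j hj]
  refine ⟨J', hJJ, ?_, b₁, ⟨hb₁, by rwa [hsum b₁ hb₁β]⟩, ?_⟩
  · have hlt : ∀ᶠ b : ι → ℕ in U, negLogSum J b < z := hUz.eventually self_mem_nhdsWithin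
    obtain ⟨b₂, ⟨hb₂, hb₂β⟩, hb₂z⟩ := ((hUB.and hUβ).and hlt).exists
    have hgt : ∀ᶠ b : ι → ℕ in U, negLogSum J b₂ < negLogSum J b :=
      hUz.eventually (Ioo_mem_nhdsLT hb₂z |> fun h => mem_of_superset h fun x hx => hx.1)
    obtain ⟨b₃, ⟨hb₃, hb₃β⟩, hb₃z⟩ := ((hUB.and hUβ).and hgt).exists
    set d : Λ := ⟨_, hΛ b₂ hb₂ b₃ hb₃⟩
    have hd0 : d ≠ 0 := by
      intro h
      refine hb₃z.ne ?_
      unfold negLogSum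
      congr 2
      refine Finset.sum_congr rfl fun j hj => ?_
      have := congrFun (congrArg Subtype.val h) j
      simp only [d, coordProj, LinearMap.coe_mk, AddHom.coe_mk, if_pos hj] at this
      have h' : (b₂ j : ℚ) = b₃ j := sub_eq_zero.1 this
      rw [Nat.cast_injective h']
    have hker : d ∈ LinearMap.ker ((coordProj J').domRestrict Λ) := by
      rw [LinearMap.mem_ker]
      ext j
      simp only [d, coordProj, LinearMap.domRestrict_apply, LinearMap.coe_mk, AddHom.coe_mk,
        Pi.zero_apply]
      split_ifs with h1 h2
      · rw [hb₂β j h1, hb₃β j h1, sub_self]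
      · rfl
      · rfl
    have hpos : 0 < Module.finrank ℚ (LinearMap.ker ((coordProj J').domRestrict Λ)) :=
      Module.finrank_pos_iff_exists_ne_zero.2 
        ⟨(⟨d, hker⟩ : LinearMap.ker ((coordProj J').domRestrict Λ)),
          fun h => hd0 (congrArg Subtype.val h)⟩
    have hrn := LinearMap.finrank_range_add_finrank_ker ((coordProj J').domRestrict Λ)
    have hrange : LinearMap.range ((coordProj J').domRestrict Λ) = Λ.map (coordProj J') :=
      LinearMap.range_domRestrict _ _
    rw [hrange] at hrn
    omega
  · rw [negLogSum, hsum b₁ hb₁β, hz']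

/-- Each derivation replaces `Λ` by one of finitely many projections of smaller rank. -/
theorem leftDeriv_iterate_negLogSum_eq_empty [Finite ι] [DecidableEq ι] (k : ℕ) (J : Finset ι)
    (B : Set (ι → ℕ)) (Λ : Submodule ℚ (ι → ℚ)) (hk : Module.finrank ℚ Λ < k)
    (hB : ∀ b ∈ B, 1 ≤ ∑ j ∈ J, (1 / 2 : ℝ) ^ b j)
    (hΛ : ∀ b ∈ B, ∀ b' ∈ B, coordProj J (fun j => (b j : ℚ) - b' j) ∈ Λ) :
    leftDeriv^[k] (negLogSum J '' B) = ∅ := by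
  induction k generalizing J B Λ with
  | zero => omega
  | succ k ih =>
    let F : {J' : Finset ι // J' ⊆ J ∧
        Module.finrank ℚ (Λ.map (coordProj J')) < Module.finrank ℚ Λ} → Set ℝ :=
      fun J' => negLogSum J'.1 '' {b ∈ B | 1 ≤ ∑ j ∈ J'.1, (1 / 2 : ℝ) ^ b j}
    have hsub : leftDeriv (negLogSum J '' B) ⊆ ⋃ J', F J' := by
      intro z hz
      obtain ⟨J', h1, h2, h3⟩ := leftDeriv_negLogSum_subset J B Λ hB hΛ hz
      exact Set.mem_iUnion.2 ⟨⟨J', h1, h2⟩, h3⟩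
    rw [Function.iterate_succ_apply]
    refine Set.subset_empty_iff.1 ((leftDeriv_iterate_mono k hsub).trans ?_)
    have : Finite {J' : Finset ι // J' ⊆ J ∧
        Module.finrank ℚ (Λ.map (coordProj J')) < Module.finrank ℚ Λ} := inferInstance
    rw [leftDeriv_iterate_iUnion, Set.iUnion_subset_iff]
    rintro ⟨J', hJ, hr⟩
    refine (ih J' _ (Λ.map (coordProj J')) (by omega) (fun b hb => hb.2) ?_).subset
    intro b hb b' hb'
    refine ⟨_, hΛ b hb.1 b' hb'.1, ?_⟩
    ext j
    simp only [coordProj, LinearMap.coe_mk, AddHom.coe_mk]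
    split_ifs with h1 h2
    · rfl
    · exact absurd (hJ h1) h2
    · rfl

end PowerSums

/-! ### Non-doubling steps of an addition chain -/

section ChainStructure

/-- The values of an addition chain: a set of positive integers containing `1` in which every other
element is a sum of two elements. -/
structure IsChainSet (V : Finset ℕ) : Prop where
  one_mem : 1 ∈ V
  pos : ∀ v ∈ V, 0 < v
  exists_add : ∀ v ∈ V, v ≠ 1 → ∃ a ∈ V, ∃ b ∈ V, a + b = v

/-- `v` is a power of two times a sum of at most `2 ^ f` terms `2 ^ (∑ i ∈ c, p i)`, where
`c ⊆ {0, …, f - 1}`. -/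
def IsSubsetPowerSum (p : ℕ → ℤ) (f v : ℕ) : Prop :=
  ∃ (g : ℤ) (l : List (Finset ℕ)), l.length ≤ 2 ^ f ∧ (∀ c ∈ l, c ⊆ Finset.range f) ∧
    (v : ℝ) = 2 ^ g * (l.map fun c => (2 : ℝ) ^ ∑ i ∈ c, p i).sum

theorem IsSubsetPowerSum.double {p : ℕ → ℤ} {f v : ℕ} (h : IsSubsetPowerSum p f v) :
    IsSubsetPowerSum p f (v + v) := by
  obtain ⟨g, l, h1, h2, h3⟩ := h
  refine ⟨g + 1, l, h1, h2, ?_⟩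
  rw [Nat.cast_add, h3, zpow_add₀ two_ne_zero, zpow_one]
  ring

/-- The new parameter is the offset `g' - g` between the two scales; inserting the index `f` into
the subsets of the second summand lets the lists be concatenated. Old representations never use
index `f`, so they survive. -/
theorem exists_isSubsetPowerSum_add {p : ℕ → ℤ} {f a b : ℕ} (ha : IsSubsetPowerSum p f a)
    (hb : IsSubsetPowerSum p f b) :
    ∃ q : ℕ → ℤ, (∀ v, IsSubsetPowerSum p f v → IsSubsetPowerSum q (f + 1) v) ∧
      IsSubsetPowerSum q (f + 1) (a + b) := by
  obtain ⟨g, l, h1, h2, h3⟩ := ha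
  obtain ⟨g', l', h1', h2', h3'⟩ := hb
  set q := Function.update p f (g' - g) with hq
  have hpq : ∀ l : List (Finset ℕ), (∀ c ∈ l, c ⊆ Finset.range f) →
      (l.map fun c => (2 : ℝ) ^ ∑ i ∈ c, q i) = l.map fun c => (2 : ℝ) ^ ∑ i ∈ c, p i := by
    intro l hl
    refine List.map_congr_left fun c hc => ?_
    congr 1
    refine Finset.sum_congr rfl fun i hi => ?_
    rw [hq, Function.update_of_ne (Finset.mem_range.1 (hl c hc hi)).ne]
  have hsub : Finset.range f ⊆ Finset.range (f + 1) := Finset.range_mono f.le_succ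
  refine ⟨q, ?_, g, l ++ l'.map (insert f), ?_, ?_, ?_⟩
  · rintro v ⟨g, l, h1, h2, h3⟩
    exact ⟨g, l, h1.trans (Nat.pow_le_pow_right two_pos f.le_succ), fun c hc => (h2 c hc).trans hsub,
      by rw [h3, hpq l h2]⟩
  · rw [List.length_append, List.length_map, pow_succ]
    omega
  · intro c hc
    rcases List.mem_append.1 hc with hc | hc
    · exact (h2 c hc).trans hsub
    · obtain ⟨c', hc', rfl⟩ := List.mem_map.1 hc
      exact Finset.insert_subset (Finset.self_mem_range_succ f) ((h2' c' hc').trans hsub)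
  · have hins : (l'.map (insert f)).map (fun c => (2 : ℝ) ^ ∑ i ∈ c, q i) =
        l'.map fun c => (2 : ℝ) ^ (g' - g) * (2 : ℝ) ^ ∑ i ∈ c, q i := by
      rw [List.map_map]
      refine List.map_congr_left fun c hc => ?_
      have hf : f ∉ c := fun h => Finset.notMem_range_self (h2' c hc h)
      rw [Function.comp_apply, Finset.sum_insert hf, zpow_add₀ two_ne_zero, hq,
        Function.update_self]
    rw [List.map_append, hins, List.sum_append, List.sum_map_mul_left, hpq l h2, hpq l' h2',
      Nat.cast_add, h3, h3', mul_add, ← mul_assoc, ← zpow_add₀ two_ne_zero, add_sub_cancel]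

/-- Equality would hold with exponent log₂ of the golden ratio, about 0.694; 3/4 is a convenient
larger value. -/
theorem one_add_two_rpow_le : 1 + (2 : ℝ) ^ (-(3 / 4) : ℝ) ≤ 2 ^ (3 / 4 : ℝ) := by
  rw [Real.rpow_neg two_pos.le]
  set t := (2 : ℝ) ^ (3 / 4 : ℝ)
  have ht0 : 0 < t := by positivity
  have ht4 : t ^ 4 = 8 := by
    rw [← Real.rpow_natCast, ← Real.rpow_mul two_pos.le]
    norm_num
  have ht : 1.65 ≤ t := by
    by_contra! h
    have : t ^ 4 < 1.65 ^ 4 := pow_lt_pow_left₀ h ht0.le (by norm_num)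
    norm_num at this
    linarith
  have : t⁻¹ ≤ t - 1 := by
    rw [inv_le_iff_one_le_mul₀ ht0]
    nlinarith
  linarith

/-- Induction by removing the maximum. A doubling doubles the bound; any other step gives at most
the maximum plus the second largest value, a factor of at most 2^(3/4), which costs 1/4. In both
cases the old bound is at least a factor 2^(3/4) below the new one, which restores the estimate for
the second largest value. -/
theorem IsChainSet.exists_structure (r : ℕ) (V : Finset ℕ) (hV : IsChainSet V)
    (hr : V.card = r + 1) :
    ∃ x ∈ V, (∀ v ∈ V, v ≤ x) ∧ ∃ f : ℕ, (x : ℝ) ≤ 2 ^ ((r : ℝ) - f / 4) ∧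
      (∀ v ∈ V, v < x → (v : ℝ) ≤ 2 ^ ((r : ℝ) - f / 4 + -(3 / 4))) ∧
      ∃ p : ℕ → ℤ, ∀ v ∈ V, IsSubsetPowerSum p f v := by
  induction r generalizing V with
  | zero =>
    obtain ⟨a, rfl⟩ := Finset.card_eq_one.1 hr
    obtain rfl : 1 = a := Finset.mem_singleton.1 hV.one_mem
    refine ⟨1, by simp, by simp, 0, by simp, by simp, 0, ?_⟩
    intro v hv
    obtain rfl : v = 1 := Finset.mem_singleton.1 hv
    exact ⟨0, [∅], by simp, by simp, by simp⟩
  | succ r ih =>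
    obtain ⟨x, hx, hmax⟩ := V.exists_max_image id ⟨1, hV.one_mem⟩
    simp only [id] at hmax
    have hx1 : x ≠ 1 := by
      rintro rfl
      have : V ⊆ {1} := fun v hv => Finset.mem_singleton.2
        (le_antisymm (hmax v hv) (hV.pos v hv))
      have := Finset.card_le_card this
      rw [hr, Finset.card_singleton] at this
      omega
    have hW : IsChainSet (V.erase x) := by
      refine ⟨Finset.mem_erase.2 ⟨hx1.symm, hV.one_mem⟩,
        fun v hv => hV.pos v (Finset.mem_of_mem_erase hv), fun v hv hv1 => ?_⟩
      obtain ⟨a, ha, b, hb, hab⟩ := hV.exists_add v (Finset.mem_of_mem_erase hv) hv1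
      have h1 := hV.pos a ha
      have h2 := hV.pos b hb
      have h3 := hmax v (Finset.mem_of_mem_erase hv)
      exact ⟨a, Finset.mem_erase.2 ⟨by omega, ha⟩, b, Finset.mem_erase.2 ⟨by omega, hb⟩, hab⟩
    obtain ⟨y, hy, hymax, f, hyle, hsnd, p, hp⟩ := ih (V.erase x) hW
      (by rw [Finset.card_erase_of_mem hx, hr]; rfl)
    obtain ⟨a, ha, b, hb, hab⟩ := hV.exists_add x hx hx1
    have ha' : a ∈ V.erase x := Finset.mem_erase.2 ⟨by have := hV.pos b hb; omega, ha⟩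
    have hb' : b ∈ V.erase x := Finset.mem_erase.2 ⟨by have := hV.pos a ha; omega, hb⟩
    have hle_y : ∀ v ∈ V, v < x → (v : ℝ) ≤ 2 ^ ((r : ℝ) - f / 4) := fun v hv hvx =>
      (Nat.cast_le.2 (hymax v (Finset.mem_erase.2 ⟨hvx.ne, hv⟩))).trans hyle
    refine ⟨x, hx, hmax, ?_⟩
    by_cases hxy : a = y ∧ b = y
    · obtain ⟨rfl, rfl⟩ := hxy
      refine ⟨f, ?_, ?_, p, ?_⟩
      · rw [← hab, Nat.cast_succ, add_sub_right_comm, Real.rpow_add two_pos, Real.rpow_one]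
        push_cast
        linarith
      · intro v hv hvx
        refine (hle_y v hv hvx).trans (Real.rpow_le_rpow_of_exponent_le one_le_two ?_)
        push_cast
        linarith
      · intro v hv
        by_cases hvx : v = x
        · rw [hvx, ← hab]
          exact (hp _ ha').double
        · exact hp v (Finset.mem_erase.2 ⟨hvx, hv⟩)
    · obtain ⟨q, hq, hqx⟩ := exists_isSubsetPowerSum_add (hp a ha') (hp b hb')
      have hE : ((r + 1 : ℕ) : ℝ) - (f + 1 : ℕ) / 4 = (r - f / 4) + 3 / 4 := by push_cast; ring
      refine ⟨f + 1, ?_, ?_, q, ?_⟩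
      · rw [hE, Real.rpow_add two_pos]
        have hsum : (x : ℝ) ≤ 2 ^ ((r : ℝ) - f / 4) + 2 ^ ((r : ℝ) - f / 4 + -(3 / 4)) := by
          rw [← hab, Nat.cast_add]
          have h1 := hymax a ha'
          have h2 := hymax b hb'
          have h3 : a < y ∨ b < y := by omega
          have h4 : (a : ℝ) ≤ y := Nat.cast_le.2 h1
          have h5 : (b : ℝ) ≤ y := Nat.cast_le.2 h2
          rcases h3 with h3 | h3
          · linarith [hsnd a ha' h3]
          · linarith [hsnd b hb' h3]
        refine hsum.trans ?_
        rw [Real.rpow_add two_pos]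
        have := mul_le_mul_of_nonneg_left one_add_two_rpow_le
          (Real.rpow_nonneg two_pos.le ((r : ℝ) - f / 4))
        linarith
      · intro v hv hvx
        rw [hE, add_neg_cancel_right]
        exact hle_y v hv hvx
      · intro v hv
        by_cases hvx : v = x
        · rwa [hvx, ← hab]
        · exact hq v (hp v (Finset.mem_erase.2 ⟨hvx, hv⟩))

theorem AdditionChain.seq_pos (c : AdditionChain) (m : Fin (c.length + 1)) : 0 < c.seq m := by
  induction m using WellFoundedLT.induction with
  | ind m ih =>
    by_cases hm : m = 0
    · rw [hm, c.seq_zero]; exact one_pos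
    · obtain ⟨i, j, hi, hj, h⟩ := c.seq_step m hm
      rw [h]
      exact Nat.add_pos_left (ih i hi) _

theorem AdditionChain.exists_structure (c : AdditionChain) :
    ∃ f : ℕ, (f : ℝ) ≤ 4 * (c.length - Real.logb 2 c.target) ∧
      ∃ p : ℕ → ℤ, IsSubsetPowerSum p f c.target := by
  -- Chains need not be increasing; terms above the target can be dropped because summands never
  -- exceed their sum.
  set V := (Finset.univ.image c.seq).filter (· ≤ c.target) with hVdef
  have hmem : ∀ v, v ∈ V ↔ (∃ i, c.seq i = v) ∧ v ≤ c.target := by simp [V]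
  have hV : IsChainSet V := by
    refine ⟨(hmem 1).2 ⟨⟨0, c.seq_zero⟩, c.seq_pos _⟩, ?_, ?_⟩
    · intro v hv
      obtain ⟨⟨i, rfl⟩, -⟩ := (hmem v).1 hv
      exact c.seq_pos i
    · intro v hv hv1
      obtain ⟨⟨m, rfl⟩, hle⟩ := (hmem v).1 hv
      obtain ⟨i, j, -, -, h⟩ := c.seq_step m (fun h => hv1 (by rw [h, c.seq_zero]))
      exact ⟨c.seq i, (hmem _).2 ⟨⟨i, rfl⟩, by omega⟩, c.seq j, (hmem _).2 ⟨⟨j, rfl⟩, by omega⟩,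
        h.symm⟩
  have hcard : V.card ≤ c.length + 1 := by
    refine (Finset.card_filter_le _ _).trans (Finset.card_image_le.trans ?_)
    simp
  obtain ⟨r, hr⟩ := Nat.exists_eq_succ_of_ne_zero (Finset.card_pos.2 ⟨1, hV.one_mem⟩).ne'
  obtain ⟨x, hx, hmax, f, hxf, -, p, hp⟩ := hV.exists_structure r V hr
  have htV : c.target ∈ V := (hmem _).2 ⟨⟨_, rfl⟩, le_rfl⟩
  obtain rfl : x = c.target := le_antisymm ((hmem x).1 hx).2 (hmax _ htV)
  refine ⟨f, ?_, p, hp _ hx⟩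
  have hlog := (Real.logb_le_iff_le_rpow one_lt_two (Nat.cast_pos.2 (hV.pos _ hx))).2 hxf
  have hrl : (r : ℝ) ≤ c.length := Nat.cast_le.2 (by omega)
  linarith

end ChainStructure

/-! ### Binary digits and logarithms -/

section BinaryDigits

theorem binaryOnes_two_mul {n : ℕ} (hn : 0 < n) : binaryOnes (2 * n) = binaryOnes n := by
  have h := Nat.digits_add 2 one_lt_two 0 n two_pos (Or.inr hn.ne')
  rw [zero_add] at h
  rw [binaryOnes, h, List.count_cons_of_ne (by norm_num), binaryOnes]

theorem binaryOnes_two_mul_add_one (n : ℕ) : binaryOnes (2 * n + 1) = binaryOnes n + 1 := by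
  have h := Nat.digits_add 2 one_lt_two 1 n one_lt_two (Or.inl one_ne_zero)
  rw [add_comm 1] at h
  rw [binaryOnes, h, List.count_cons_self, binaryOnes]

theorem binaryOnes_two_pow_mul {n : ℕ} (hn : 0 < n) (t : ℕ) :
    binaryOnes (2 ^ t * n) = binaryOnes n := by
  induction t with
  | zero => simp
  | succ t ih => rw [pow_succ', mul_assoc, binaryOnes_two_mul (by positivity), ih]

theorem natLog_two_pow_mul {n : ℕ} (hn : 0 < n) (t : ℕ) :
    Nat.log 2 (2 ^ t * n) = Nat.log 2 n + t := by
  induction t with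
  | zero => simp
  | succ t ih =>
    rw [pow_succ', mul_assoc, mul_comm, Nat.log_mul_base one_lt_two (by positivity), ih]
    rfl

theorem natLog_two_mul_add_one {n : ℕ} (hn : 0 < n) : Nat.log 2 (2 * n + 1) = Nat.log 2 n + 1 := by
  rw [Nat.log_of_one_lt_of_le one_lt_two (by omega)]
  congr 2
  omega

theorem logb_two_pow_mul {n : ℕ} (hn : 0 < n) (t : ℕ) :
    Real.logb 2 ((2 ^ t * n : ℕ) : ℝ) = t + Real.logb 2 n := by
  have : (n : ℝ) ≠ 0 := by positivity
  rw [Nat.cast_mul, Nat.cast_pow, Nat.cast_ofNat, Real.logb_mul (by positivity) this,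
    Real.logb_pow, Real.logb_self_eq_one one_lt_two, mul_one]

theorem natLog_le_logb {n : ℕ} (hn : 0 < n) : (Nat.log 2 n : ℝ) ≤ Real.logb 2 n := by
  rw [Real.le_logb_iff_rpow_le one_lt_two (by positivity), Real.rpow_natCast]
  exact_mod_cast Nat.pow_log_le_self 2 hn.ne'

theorem logb_lt_natLog_add_one {n : ℕ} (hn : 0 < n) : Real.logb 2 n < Nat.log 2 n + 1 := by
  rw [Real.logb_lt_iff_lt_rpow one_lt_two (by positivity)]
  have := Nat.lt_pow_succ_log_self one_lt_two n
  exact_mod_cast this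

end BinaryDigits

/-! ### Limits obtained by appending binary ones -/

section Mantissas

open Filter Topology

/-- The values `⌊log₂ n⌋ - log₂ n` of the positive integers with `j` binary ones. -/
def negMantissaLogs (j : ℕ) : Set ℝ :=
  {x | ∃ n : ℕ, 0 < n ∧ binaryOnes n = j ∧ (Nat.log 2 n : ℝ) - Real.logb 2 n = x}

/-- The integers 2^(t+1) n + 1 have one more binary one than n, and their values increase to that of
n from strictly below. -/
theorem negMantissaLogs_subset_leftDeriv (j : ℕ) :
    negMantissaLogs j ⊆ leftDeriv (negMantissaLogs (j + 1)) := by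
  rintro _ ⟨n, hn, hj, rfl⟩
  have hn' : (0 : ℝ) < n := Nat.cast_pos.2 hn
  set x : ℕ → ℝ := fun t =>
    (Nat.log 2 n : ℝ) - Real.logb 2 n - Real.logb 2 (1 + (1 / 2) ^ (t + 1) / n) with hx
  have hmem : ∀ t, x t ∈ negMantissaLogs (j + 1) := by
    intro t
    have hpos : 0 < 2 ^ t * n := by positivity
    refine ⟨2 * (2 ^ t * n) + 1, by omega, ?_, ?_⟩
    · rw [binaryOnes_two_mul_add_one, binaryOnes_two_pow_mul hn, hj]
    · rw [natLog_two_mul_add_one hpos, natLog_two_pow_mul hn, hx]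
      have h : ((2 * (2 ^ t * n) + 1 : ℕ) : ℝ) =
          ((2 ^ (t + 1) * n : ℕ) : ℝ) * (1 + (1 / 2) ^ (t + 1) / n) := by
        have h2 : (2 : ℝ) ^ (t + 1) * (1 / 2) ^ (t + 1) = 1 := by
          rw [← mul_pow]; norm_num
        rw [mul_add, Nat.cast_mul, mul_one, Nat.cast_pow, Nat.cast_ofNat, mul_assoc,
          mul_div_cancel₀ _ hn'.ne', h2]
        push_cast
        ring
      rw [h, Real.logb_mul (by positivity) (by positivity), logb_two_pow_mul hn]
      push_cast
      ring
  have hlt : ∀ t, x t < (Nat.log 2 n : ℝ) - Real.logb 2 n := by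
    intro t
    have : 0 < Real.logb 2 (1 + (1 / 2) ^ (t + 1) / n) :=
      Real.logb_pos one_lt_two (lt_add_of_pos_right _ (by positivity))
    simp only [hx]
    linarith
  have hlim : Tendsto x atTop (𝓝 ((Nat.log 2 n : ℝ) - Real.logb 2 n)) := by
    have h1 : Tendsto (fun t : ℕ => (1 : ℝ) + (1 / 2) ^ (t + 1) / n) atTop (𝓝 (1 + 0 / n)) :=
      ((((tendsto_pow_atTop_nhds_zero_of_lt_one (r := (1 / 2 : ℝ)) (by norm_num)
        (by norm_num)).comp (tendsto_add_atTop_nat 1)).div_const _).const_add _)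
    have h2 := (Real.continuousAt_logb (b := 2) (x := 1 + 0 / (n : ℝ)) (by simp)).tendsto.comp h1
    have h3 := h2.const_sub ((Nat.log 2 n : ℝ) - Real.logb 2 n)
    rw [zero_div, add_zero, Real.logb_one, sub_zero] at h3
    exact h3
  refine mem_leftDeriv_of_forall fun y hy => ?_
  obtain ⟨t, ht⟩ := (hlim.eventually (lt_mem_nhds hy)).exists
  exact ⟨x t, hmem t, ht, hlt t⟩

theorem zero_mem_leftDeriv_iterate_negMantissaLogs (k : ℕ) :
    (0 : ℝ) ∈ leftDeriv^[k] (negMantissaLogs (k + 1)) := by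
  have h : ∀ k, negMantissaLogs 1 ⊆ leftDeriv^[k] (negMantissaLogs (k + 1)) := by
    intro k
    induction k with
    | zero => exact subset_rfl
    | succ k ih =>
      rw [Function.iterate_succ_apply]
      exact ih.trans (leftDeriv_iterate_mono k (negMantissaLogs_subset_leftDeriv (k + 1)))
  exact h k ⟨1, one_pos, by simp [binaryOnes], by simp⟩

end Mantissas

/-! ### Defects of admissible sets: bounds, limit points, well-ordering -/

section Defects

variable {A : Set AdditionChain}

theorem IsAdmissible.exists_chain (hA : IsAdmissible A) {n : ℕ} (hn : 0 < n) :
    ∃ c ∈ A, c.target = n ∧ c.length = chainLength A n := by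
  obtain ⟨c, hc, hcn, -⟩ := hA.exists_short n hn
  have hne : {r : ℕ | ∃ c ∈ A, c.target = n ∧ c.length = r}.Nonempty := ⟨_, c, hc, hcn, rfl⟩
  exact Nat.sInf_mem hne

theorem IsAdmissible.chainLength_le (hA : IsAdmissible A) {n : ℕ} (hn : 0 < n) :
    chainLength A n ≤ Nat.log 2 n + binaryOnes n - 1 := by
  obtain ⟨c, hc, hcn, hle⟩ := hA.exists_short n hn
  have hmem : c.length ∈ {r : ℕ | ∃ c ∈ A, c.target = n ∧ c.length = r} := ⟨c, hc, hcn, rfl⟩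
  exact (Nat.sInf_le hmem).trans hle

theorem IsAdmissible.exists_structure (hA : IsAdmissible A) {n : ℕ} (hn : 0 < n) :
    ∃ f : ℕ, (f : ℝ) ≤ 4 * defect A n ∧ ∃ p : ℕ → ℤ, IsSubsetPowerSum p f n := by
  obtain ⟨c, -, rfl, hc⟩ := hA.exists_chain hn
  rw [defect, ← hc]
  exact c.exists_structure

theorem IsAdmissible.defect_nonneg (hA : IsAdmissible A) {n : ℕ} (hn : 0 < n) :
    0 ≤ defect A n := by
  obtain ⟨f, hf, -⟩ := hA.exists_structure hn
  have : (0 : ℝ) ≤ f := f.cast_nonneg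
  linarith

theorem IsAdmissible.natLog_le_chainLength (hA : IsAdmissible A) {n : ℕ} (hn : 0 < n) :
    Nat.log 2 n ≤ chainLength A n := by
  have h1 := hA.defect_nonneg hn
  rw [defect] at h1
  have h2 := natLog_le_logb hn
  have h3 : (Nat.log 2 n : ℝ) ≤ chainLength A n := by linarith
  exact_mod_cast h3

theorem IsAdmissible.chainLength_two_pow_mul_le (hA : IsAdmissible A) {n : ℕ} (hn : 0 < n) (t : ℕ) :
    chainLength A (2 ^ t * n) ≤ t + chainLength A n := by
  induction t with
  | zero => simp
  | succ t ih =>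
    rw [pow_succ', mul_assoc]
    have := hA.length_double (2 ^ t * n) (by positivity)
    omega

theorem IsAdmissible.exists_stable (hA : IsAdmissible A) {n : ℕ} (hn : 0 < n) :
    ∃ K, IsStableNumber A (2 ^ K * n) := by
  -- The subtraction never truncates, since ℓ(2^K n) ≥ ⌊log₂ n⌋ + K; past a minimiser, doubling must
  -- cost exactly one each time.
  let u : ℕ → ℕ := fun K => chainLength A (2 ^ K * n) - K
  refine ⟨Function.argmin u, fun t => ?_⟩
  set K := Function.argmin u
  have hmin : u K ≤ u (t + K) := Function.argmin_le u (t + K)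
  have h1 := hA.chainLength_two_pow_mul_le (n := 2 ^ K * n) (by positivity) t
  have h2 := hA.natLog_le_chainLength (n := 2 ^ K * n) (by positivity)
  have h3 := hA.natLog_le_chainLength (n := 2 ^ (t + K) * n) (by positivity)
  rw [natLog_two_pow_mul hn] at h2 h3
  simp only [u] at hmin
  rw [← mul_assoc, ← pow_add] at h1 ⊢
  omega

/-- With k+1 binary ones, the length exceeds ⌊log₂⌋ by an integer between 0 and k; doubling changes
neither the number of ones nor ⌊log₂ n⌋ - log₂ n, so n may be replaced by a stable multiple. -/
theorem IsAdmissible.negMantissaLogs_subset (hA : IsAdmissible A) (k : ℕ) :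
    negMantissaLogs (k + 1) ⊆ ⋃ i : Fin (k + 1), (· + (i : ℝ)) ⁻¹' stableDefectSet A := by
  rintro _ ⟨n, hn, hk, rfl⟩
  obtain ⟨K, hK⟩ := hA.exists_stable hn
  have hpos : 0 < 2 ^ K * n := by positivity
  have h1 := hA.chainLength_le hpos
  have h2 := hA.natLog_le_chainLength hpos
  rw [natLog_two_pow_mul hn, binaryOnes_two_pow_mul hn, hk] at h1
  rw [natLog_two_pow_mul hn] at h2
  obtain ⟨i, hi⟩ := Nat.exists_eq_add_of_le h2
  refine Set.mem_iUnion.2 ⟨⟨i, by omega⟩, 2 ^ K * n, hpos, hK, ?_⟩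
  rw [defect, hi, logb_two_pow_mul hn]
  push_cast
  ring

theorem IsAdmissible.exists_mem_leftDeriv_stable (hA : IsAdmissible A) (k : ℕ) :
    ∃ y ≤ (k : ℝ), y ∈ leftDeriv^[k] (stableDefectSet A) := by
  have h := leftDeriv_iterate_mono k (hA.negMantissaLogs_subset k)
    (zero_mem_leftDeriv_iterate_negMantissaLogs k)
  rw [leftDeriv_iterate_iUnion, Set.mem_iUnion] at h
  obtain ⟨i, hi⟩ := h
  rw [leftDeriv_iterate_preimage_add] at hi
  exact ⟨0 + i, by rw [zero_add]; exact_mod_cast Nat.lt_succ_iff.1 i.2, hi⟩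

theorem stableDefectSet_subset : stableDefectSet A ⊆ defectSet A :=
  fun _ ⟨n, hn, _, h⟩ => ⟨n, hn, h⟩

/-- The exponent vectors `b` with `b_j = m - ∑ i ∈ l_j, p i` for which `∑ 2^{-b_j} ≥ 1`. -/
def exponentVectors (l : List (Finset ℕ)) : Set (Fin l.length → ℕ) :=
  {b | 1 ≤ ∑ j, (1 / 2 : ℝ) ^ b j ∧
    ∃ (m : ℤ) (p : ℕ → ℤ), ∀ j : Fin l.length, (b j : ℤ) = m - ∑ i ∈ l[j], p i}

/-- Differences of these vectors lie in the image of a space of dimension F + 1: one common shift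
and F parameters. -/
theorem leftDeriv_iterate_exponentVectors {F k : ℕ} (hF : F + 1 < k) (l : List (Finset ℕ))
    (hl : ∀ c ∈ l, c ⊆ Finset.range F) :
    leftDeriv^[k] (negLogSum Finset.univ '' exponentVectors l) = ∅ := by
  let φ : (ℚ × (Fin F → ℚ)) →ₗ[ℚ] (Fin l.length → ℚ) :=
    { toFun := fun v j => v.1 - ∑ i : Fin F, if (i : ℕ) ∈ l[j] then v.2 i else 0
      map_add' := by
        intro v w
        ext j
        have : ∀ i : Fin F, (if (i : ℕ) ∈ l[j] then v.2 i + w.2 i else 0) =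
          (if (i : ℕ) ∈ l[j] then v.2 i else 0) + if (i : ℕ) ∈ l[j] then w.2 i else 0 := by
          intro i; split_ifs <;> simp
        simp only [Prod.fst_add, Prod.snd_add, Pi.add_apply, this, Finset.sum_add_distrib]
        ring
      map_smul' := by
        intro c v
        ext j
        simp only [Prod.smul_fst, Prod.smul_snd, Pi.smul_apply, smul_eq_mul, RingHom.id_apply,
          mul_sub, Finset.mul_sum, mul_ite, mul_zero] }
  refine leftDeriv_iterate_negLogSum_eq_empty k Finset.univ _ (LinearMap.range φ) ?_
    (fun b hb => hb.1) ?_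
  · refine (LinearMap.finrank_range_le φ).trans_lt ?_
    rw [Module.finrank_prod, Module.finrank_self, Module.finrank_fin_fun]
    omega
  · rintro b ⟨-, m, p, hb⟩ b' ⟨-, m', p', hb'⟩
    refine ⟨((m - m' : ℤ), fun i => ((p i - p' i : ℤ) : ℚ)), ?_⟩
    ext j
    have hsum : ∀ q : ℕ → ℚ, ∑ i : Fin F, (if (i : ℕ) ∈ l[j] then q i else 0) =
        ∑ i ∈ l[j], q i := by
      intro q
      rw [← Finset.sum_range (fun i => if i ∈ l[j] then q i else 0), Finset.sum_ite_mem,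
        Finset.inter_eq_right.2 (hl l[j] (List.getElem_mem _))]
    have h1 : (b j : ℚ) = m - ∑ i ∈ l[j], (p i : ℚ) := by exact_mod_cast hb j
    have h2 : (b' j : ℚ) = m' - ∑ i ∈ l[j], (p' i : ℚ) := by exact_mod_cast hb' j
    simp only [φ, coordProj, LinearMap.coe_mk, AddHom.coe_mk, Finset.mem_univ, if_true]
    rw [hsum (fun i => ((p i - p' i : ℤ) : ℚ)), h1, h2]
    push_cast
    rw [Finset.sum_sub_distrib]
    ring

theorem exists_exponentVector {p : ℕ → ℤ} {f n : ℕ} (hn : 0 < n) (h : IsSubsetPowerSum p f n) :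
    ∃ l : List (Finset ℕ), l.length ≤ 2 ^ f ∧ (∀ c ∈ l, c ⊆ Finset.range f) ∧
      (Nat.log 2 n : ℝ) - Real.logb 2 n ∈ negLogSum Finset.univ '' exponentVectors l := by
  obtain ⟨g, l, hlen, hl, hsum⟩ := h
  refine ⟨l, hlen, hl, ?_⟩
  -- Each term is at most n < 2^(a+1), so its exponent is at most a: dividing by 2^a makes the
  -- negated exponents natural numbers and the sum at least 1.
  set a := Nat.log 2 n with ha
  have hsum' : (n : ℝ) = ∑ j : Fin l.length, (2 : ℝ) ^ (g + ∑ i ∈ l[j], p i) := by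
    rw [hsum, ← Fin.sum_univ_fun_getElem, Finset.mul_sum]
    exact Finset.sum_congr rfl fun j _ => (zpow_add₀ two_ne_zero _ _).symm
  have hub : (n : ℝ) < 2 ^ ((a : ℤ) + 1) := by
    have := Nat.lt_pow_succ_log_self one_lt_two n
    exact_mod_cast this
  have hlb : (2 : ℝ) ^ a ≤ n := by exact_mod_cast Nat.pow_log_le_self 2 hn.ne'
  have hle : ∀ j : Fin l.length, 0 ≤ (a : ℤ) - (g + ∑ i ∈ l[j], p i) := by
    intro j
    have h1 : (2 : ℝ) ^ (g + ∑ i ∈ l[j], p i) ≤ n := by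
      rw [hsum']
      exact Finset.single_le_sum (f := fun j : Fin l.length => (2 : ℝ) ^ (g + ∑ i ∈ l[j], p i))
        (fun _ _ => by positivity) (Finset.mem_univ j)
    have h2 := (zpow_lt_zpow_iff_right₀ (one_lt_two (α := ℝ))).1 (h1.trans_lt hub)
    omega
  let b : Fin l.length → ℕ := fun j => ((a : ℤ) - (g + ∑ i ∈ l[j], p i)).toNat
  have hb : ∀ j, (b j : ℤ) = (a : ℤ) - (g + ∑ i ∈ l[j], p i) := fun j => Int.toNat_of_nonneg (hle j)
  have hbsum : ∑ j, (1 / 2 : ℝ) ^ b j = n / 2 ^ a := by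
    rw [hsum', Finset.sum_div]
    refine Finset.sum_congr rfl fun j _ => ?_
    rw [one_div, inv_pow, ← zpow_natCast, hb j, ← zpow_neg, neg_sub, zpow_sub₀ two_ne_zero,
      zpow_natCast]
  refine ⟨b, ⟨?_, a - g, p, fun j => by rw [hb j]; ring⟩, ?_⟩
  · rw [hbsum, one_le_div (by positivity)]
    exact hlb
  · rw [negLogSum, hbsum, Real.logb_div (by positivity) (by positivity), Real.logb_pow,
      Real.logb_self_eq_one one_lt_two]
    ring

theorem finite_lists_of_subsets (N F : ℕ) :
    {l : List (Finset ℕ) | l.length ≤ N ∧ ∀ c ∈ l, c ⊆ Finset.range F}.Finite := by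
  have : Finite {c : Finset ℕ // c ⊆ Finset.range F} :=
    Finite.of_equiv {c // c ∈ (Finset.range F).powerset}
      (Equiv.subtypeEquivRight fun _ => Finset.mem_powerset)
  refine ((List.finite_length_le {c : Finset ℕ // c ⊆ Finset.range F} N).image
    (List.map Subtype.val)).subset ?_
  rintro l ⟨h1, h2⟩
  lift l to List {c : Finset ℕ // c ⊆ Finset.range F} using h2
  exact ⟨l, by simpa using h1, rfl⟩

/-- The lists of at most `2 ^ F` subsets of `{0, …, F - 1}`. -/
abbrev SubsetLists (F : ℕ) : Type :=
  {l : List (Finset ℕ) // l.length ≤ 2 ^ F ∧ ∀ c ∈ l, c ⊆ Finset.range F}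

instance (F : ℕ) : Finite (SubsetLists F) := (finite_lists_of_subsets (2 ^ F) F).to_subtype

/-- Here `q` records the integer ℓ(n) - ⌊log₂ n⌋, which is below T + 1, and the shape of the power
sum; only finitely many pairs occur. -/
theorem IsAdmissible.defectSet_inter_subset (hA : IsAdmissible A) {T : ℝ} {F : ℕ}
    (hF : ∀ f : ℕ, (f : ℝ) < 4 * T → f ≤ F) :
    defectSet A ∩ Set.Iio T ⊆ ⋃ q : Fin ⌈T + 1⌉₊ × SubsetLists F,
      (· + -(q.1 : ℝ)) ⁻¹' (negLogSum Finset.univ '' exponentVectors q.2.1) := by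
  rintro _ ⟨⟨n, hn, rfl⟩, hT⟩
  obtain ⟨f, hf, p, hp⟩ := hA.exists_structure hn
  have hfF : f ≤ F := hF f (by have := Set.mem_Iio.1 hT; linarith)
  obtain ⟨l, hlen, hl, hmem⟩ := exists_exponentVector hn hp
  obtain ⟨i, hi⟩ := Nat.exists_eq_add_of_le (hA.natLog_le_chainLength hn)
  have hdef : defect A n + -(i : ℝ) = Nat.log 2 n - Real.logb 2 n := by
    rw [defect, hi]
    push_cast
    ring
  have hiT : i < ⌈T + 1⌉₊ := by
    rw [Nat.lt_ceil]
    have := logb_lt_natLog_add_one hn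
    have := Set.mem_Iio.1 hT
    linarith
  refine Set.mem_iUnion.2 ⟨(⟨i, hiT⟩, ⟨l, hlen.trans (Nat.pow_le_pow_right two_pos hfF),
    fun c hc => (hl c hc).trans (Finset.range_mono hfF)⟩), ?_⟩
  rw [Set.mem_preimage, hdef]
  exact hmem

theorem IsAdmissible.leftDeriv_iterate_defectSet (hA : IsAdmissible A) {T : ℝ} {F k : ℕ}
    (hF : ∀ f : ℕ, (f : ℝ) < 4 * T → f ≤ F) (hk : F + 1 < k) :
    leftDeriv^[k] (defectSet A ∩ Set.Iio T) = ∅ := by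
  refine Set.subset_empty_iff.1 ((leftDeriv_iterate_mono k
    (hA.defectSet_inter_subset hF)).trans ?_)
  rw [leftDeriv_iterate_iUnion, Set.iUnion_subset_iff]
  intro q
  rw [leftDeriv_iterate_preimage_add, leftDeriv_iterate_exponentVectors hk q.2.1 q.2.2.2]
  exact subset_rfl

theorem IsAdmissible.defectSet_isWF (hA : IsAdmissible A) : (defectSet A).IsWF := by
  have key : ∀ T : ℝ, (defectSet A ∩ Set.Iio T).IsWF := by
    intro T
    have hcov := hA.defectSet_inter_subset (T := T) (F := ⌈4 * T⌉₊)
      fun f hf => (Nat.lt_ceil.2 hf).le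
    have := Fintype.ofFinite (Fin ⌈T + 1⌉₊ × SubsetLists ⌈4 * T⌉₊)
    have hpwo : ∀ q : Fin ⌈T + 1⌉₊ × SubsetLists ⌈4 * T⌉₊,
        ((· + -(q.1 : ℝ)) ⁻¹' (negLogSum Finset.univ '' exponentVectors q.2.1)).IsPWO := by
      intro q
      have h := negLogSum_image_isPWO Finset.univ (exponentVectors q.2.1) fun b hb => hb.1
      refine (h.image_of_monotoneOn (f := (· + (q.1 : ℝ)))
        (fun x _ y _ hxy => by simpa using hxy)).mono fun x hx => ⟨_, hx, by simp⟩
    refine Set.IsPWO.isWF (Set.IsPWO.mono ((Finset.isPWO_bUnion Finset.univ).2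
      fun q _ => hpwo q) ?_)
    simpa using hcov
  -- A descending sequence stays below its first term plus one, so well-foundedness of the truncated
  -- sets suffices.
  rw [Set.isWF_iff_no_descending_seq]
  intro f hf hmem
  refine Set.isWF_iff_no_descending_seq.1 (key (f 0 + 1)) f hf fun n => ⟨hmem n, ?_⟩
  exact (hf.antitone n.zero_le).trans_lt (lt_add_one _)

end Defects

/-! ### Numerical bounds for C_s -/

section SchonhageConstant

theorem schonhageTerm_nonneg (k : ℕ) : 0 ≤ schonhageTerm k :=
  Real.logb_nonneg one_lt_two (le_add_of_nonneg_right (by positivity))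

/-- Uses ln(1 + x) ≤ x and 2^k ≥ k + 1 to compare with a geometric series of ratio 1/64. -/
theorem schonhageTerm_le (k : ℕ) :
    schonhageTerm k ≤ 2 / Real.log 2 * (1 / 64) * (1 / 64) ^ k := by
  have hlog : 0 < Real.log 2 := Real.log_pos one_lt_two
  have hk : k + 1 ≤ 2 ^ k := Nat.lt_two_pow_self
  have hpow : (2 : ℝ) ^ (-6 * 2 ^ k + 1 : ℤ) = 2 * (1 / 64) ^ (2 ^ k) := by
    rw [zpow_add₀ two_ne_zero, zpow_one, zpow_mul, mul_comm]
    congr 1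
    have h : ((2 : ℤ) ^ k) = ((2 ^ k : ℕ) : ℤ) := by push_cast; rfl
    rw [h, zpow_natCast]
    norm_num
  have h2 : (1 / 64 : ℝ) ^ (2 ^ k) ≤ (1 / 64) ^ (k + 1) :=
    pow_le_pow_of_le_one (by norm_num) (by norm_num) hk
  rw [schonhageTerm, hpow, Real.logb, div_le_iff₀ hlog]
  have h3 : Real.log (1 + 2 * (1 / 64) ^ (2 ^ k)) ≤ 2 * (1 / 64) ^ (2 ^ k) := by
    have := Real.log_le_sub_one_of_pos (x := 1 + 2 * (1 / 64 : ℝ) ^ (2 ^ k)) (by positivity)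
    linarith
  have h4 : 2 / Real.log 2 * (1 / 64) * (1 / 64) ^ k * Real.log 2 = 2 * (1 / 64) ^ (k + 1) := by
    field_simp
    ring
  rw [h4]
  linarith

theorem hasSum_schonhage_majorant :
    HasSum (fun k : ℕ => 2 / Real.log 2 * (1 / 64) * (1 / 64) ^ k) (2 / 63 / Real.log 2) := by
  have h := (hasSum_geometric_of_lt_one (r := (1 / 64 : ℝ)) (by norm_num) (by norm_num)).mul_left
    (2 / Real.log 2 * (1 / 64))
  have h' : 2 / Real.log 2 * (1 / 64) * (1 - 1 / 64)⁻¹ = 2 / 63 / Real.log 2 := by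
    rw [show (1 - 1 / 64 : ℝ)⁻¹ = 64 / 63 by norm_num]
    ring
  rwa [h'] at h

theorem summable_schonhageTerm : Summable schonhageTerm :=
  Summable.of_nonneg_of_le schonhageTerm_nonneg schonhageTerm_le hasSum_schonhage_majorant.summable

theorem tsum_schonhageTerm_le : ∑' k, schonhageTerm k ≤ 2 / 63 / Real.log 2 :=
  hasSum_le schonhageTerm_le summable_schonhageTerm.hasSum hasSum_schonhage_majorant

theorem logb_two_le_div {x : ℝ} (hx : 0 < x) (p q : ℕ) (hq : 0 < q) (h : x ^ q ≤ 2 ^ p) :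
    Real.logb 2 x ≤ p / q := by
  rw [le_div_iff₀ (by positivity), mul_comm, ← Real.logb_pow,
    Real.logb_le_iff_le_rpow one_lt_two (by positivity), Real.rpow_natCast]
  exact h

theorem div_le_logb_two {x : ℝ} (hx : 0 < x) (p q : ℕ) (hq : 0 < q) (h : 2 ^ p ≤ x ^ q) :
    p / q ≤ Real.logb 2 x := by
  rw [div_le_iff₀ (by positivity), mul_comm, ← Real.logb_pow,
    Real.le_logb_iff_rpow_le one_lt_two (by positivity), Real.rpow_natCast]
  exact h

/-- Two terms of the series for ln(4/3) = 2 artanh(1/7). -/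
theorem log_four_thirds_ge : 23 / 80 ≤ Real.log (4 / 3) := by
  have h := Real.hasSum_log_sub_log_of_abs_lt_one (x := 1 / 7) (by norm_num [abs_lt])
  have h1 := sum_le_hasSum (Finset.range 2) (fun i _ => by positivity) h
  rw [← Real.log_div (by norm_num) (by norm_num)] at h1
  norm_num [Finset.sum_range_succ] at h1
  norm_num
  linarith

theorem log_four_thirds_le : Real.log (4 / 3) ≤ 1 / 3 :=
  (Real.log_le_sub_one_of_pos (by norm_num)).trans (by norm_num)

theorem schonhageConst_lt : schonhageConst < 2.13 := by
  -- 65/41 and, below, 9/5 are close upper approximations to log₂ 3 and log₂(80/23).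
  have h1 := logb_two_le_div (x := 3) (by norm_num) 65 41 (by norm_num) (by norm_num)
  have h2 : 9 / 5 * (-1) ≤ Real.logb 2 (Real.log (4 / 3)) := by
    have h3 := logb_two_le_div (x := 80 / 23) (by norm_num) 9 5 (by norm_num) (by norm_num)
    have h4 := Real.logb_le_logb_of_le (b := 2) one_lt_two (by norm_num) log_four_thirds_ge
    have h5 : Real.logb 2 (23 / 80) = -Real.logb 2 (80 / 23) := by
      rw [← Real.logb_inv]; norm_num
    push_cast at h3
    linarith
  have h6 := tsum_schonhageTerm_le
  have h7 : 1.4426 ≤ 1 / Real.log 2 := by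
    rw [le_div_iff₀ (Real.log_pos one_lt_two)]
    have := Real.log_two_lt_d9
    linarith
  have h8 : 1 / Real.log 2 ≤ 1.4427 := by
    rw [div_le_iff₀ (Real.log_pos one_lt_two)]
    have := Real.log_two_gt_d9
    linarith
  have h9 : 2 / 63 / Real.log 2 = 2 / 63 * (1 / Real.log 2) := by ring
  rw [h9] at h6
  push_cast at h1
  rw [schonhageConst]
  linarith

theorem lt_schonhageConst : 7 / 4 < schonhageConst := by
  have h1 := div_le_logb_two (x := 3) (by norm_num) 19 12 (by norm_num) (by norm_num)
  have h2 : Real.logb 2 (Real.log (4 / 3)) ≤ -Real.logb 2 3 := by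
    rw [← Real.logb_inv]
    exact Real.logb_le_logb_of_le one_lt_two (Real.log_pos (by norm_num))
      (log_four_thirds_le.trans (by norm_num))
  have h3 : 0 ≤ ∑' k, schonhageTerm k := tsum_nonneg schonhageTerm_nonneg
  have h8 : 1 / Real.log 2 ≤ 1.4427 := by
    rw [div_le_iff₀ (Real.log_pos one_lt_two)]
    have := Real.log_two_gt_d9
    linarith
  push_cast at h1
  rw [schonhageConst]
  linarith

theorem add_one_pow_four_le (k : ℕ) : (k + 1) ^ 4 ≤ 2 ^ (k + 6) := by
  obtain h | h := Nat.lt_or_ge k 7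
  · interval_cases k <;> norm_num
  · induction k, h using Nat.le_induction with
    | base => norm_num
    | succ k hk ih =>
      rw [show k + 1 + 6 = (k + 6) + 1 from rfl, pow_succ 2 (k + 6)]
      nlinarith [pow_pos (show 0 < k by omega) 2, pow_pos (show 0 < k by omega) 3]

theorem logb_add_one_le (k : ℕ) : Real.logb 2 ((k : ℝ) + 1) ≤ (k + 6) / 4 := by
  have h := logb_two_le_div (x := (k : ℝ) + 1) (by positivity) (k + 6) 4 (by norm_num)
    (by exact_mod_cast add_one_pow_four_le k)
  exact_mod_cast h

end SchonhageConstant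

/-! ### Assembly of the bounds -/

theorem IsAdmissible.hasOmegaCutoff_stable {A : Set AdditionChain} (hA : IsAdmissible A) (k : ℕ) :
    HasOmegaCutoff (stableDefectSet A) k ∧ stableCutoff A k ≤ k := by
  have : WellFoundedLT (stableDefectSet A) := ⟨hA.defectSet_isWF.mono stableDefectSet_subset⟩
  obtain ⟨y, hyk, hy⟩ := hA.exists_mem_leftDeriv_stable k
  exact ⟨hasOmegaCutoff_of_mem_leftDeriv hy, (omegaCutoff_le_of_mem_leftDeriv hy).trans hyk⟩

theorem IsAdmissible.hasOmegaCutoff {A : Set AdditionChain} (hA : IsAdmissible A) (k : ℕ) :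
    HasOmegaCutoff (defectSet A) k := by
  have : WellFoundedLT (defectSet A) := ⟨hA.defectSet_isWF⟩
  obtain ⟨y, -, hy⟩ := hA.exists_mem_leftDeriv_stable k
  exact hasOmegaCutoff_of_mem_leftDeriv (leftDeriv_iterate_mono k stableDefectSet_subset hy)

theorem IsAdmissible.lt_cutoff {A : Set AdditionChain} (hA : IsAdmissible A) (k : ℕ) :
    Real.logb 2 ((k : ℝ) + 1) - schonhageConst < cutoff A k := by
  -- This is the threshold at which f < 4T forces f + 1 < k.
  have hT : Real.logb 2 ((k : ℝ) + 1) - schonhageConst < (k - 1) / 4 := by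
    have h1 := logb_add_one_le k
    have h2 := lt_schonhageConst
    linarith
  set T := Real.logb 2 ((k : ℝ) + 1) - schonhageConst
  refine lt_omegaCutoff (hA.hasOmegaCutoff k) ?_ ?_
  · have hf : ∀ f : ℕ, (f : ℝ) < 4 * T → f + 1 < k := by
      intro f hf
      have : (f : ℝ) + 1 < k := by linarith
      exact_mod_cast this
    -- For k < 2 there is no natural F with F + 1 < k, but then T ≤ 0 and no defect lies below T.
    obtain hk | hk := Nat.lt_or_ge k 2
    · have hempty : defectSet A ∩ Set.Iio T = ∅ := by
        refine Set.eq_empty_iff_forall_notMem.2 ?_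
        rintro _ ⟨⟨n, hn, rfl⟩, h⟩
        have h0 := (hA.defect_nonneg hn).trans_lt h
        have := hf 0 (by push_cast; linarith)
        omega
      rw [hempty, leftDeriv_iterate_empty]
    · exact hA.leftDeriv_iterate_defectSet (F := k - 2)
        (fun f h => by have := hf f h; omega) (by omega)
  · rintro rfl _ ⟨n, hn, rfl⟩
    refine lt_of_lt_of_le ?_ (hA.defect_nonneg hn)
    push_cast at hT
    linarith

theorem mainTheorem5 :
    Summable schonhageTerm ∧
    ∀ (A : Set AdditionChain), IsAdmissible A → ∀ k : ℕ,
      HasOmegaCutoff (defectSet A) k ∧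
      HasOmegaCutoff (stableDefectSet A) k ∧
      Real.logb 2 ((k : ℝ) + 1) - 2.13 < Real.logb 2 ((k : ℝ) + 1) - schonhageConst ∧
      Real.logb 2 ((k : ℝ) + 1) - schonhageConst < cutoff A k ∧
      cutoff A k ≤ stableCutoff A k ∧
      stableCutoff A k ≤ (k : ℝ) := by
  refine ⟨summable_schonhageTerm, fun A hA k => ?_⟩
  obtain ⟨hst, hle⟩ := hA.hasOmegaCutoff_stable k
  exact ⟨hA.hasOmegaCutoff k, hst, sub_lt_sub_left schonhageConst_lt _, hA.lt_cutoff k,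
    omegaCutoff_mono (hA.hasOmegaCutoff k) hst stableDefectSet_subset, hle⟩
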